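/- Let $L\in\mathbb R^{m\times m}$ be symmetric positive definite, $\langle u,v\rangle=v^Tu$, and let $G:\mathbb R^m\to[0,\infty)^m$ and $g:\mathbb R^m\to\mathbb R^m$ satisfy $g=-\nabla\langle G(\cdot),1\rangle$, with $g$ Lipschitz continuous with constant $\ell_g>0$ in the Euclidean norm. Put $E[v]=\frac12\langle v,Lv\rangle+\langle G(v),1\rangle$ and, for a stabilization parameter $\kappa\ge 2\ell_g$, $L_\kappa=L+\kappa I$ and $g_\kappa(u)=g(u)+\kappa u$. Let $\varphi_0(z)=e^z$, $\varphi_j(z)=\int_0^1e^{(1-s)z}\frac{s^{j-1}}{(j-1)!}\,ds$ for $j\ge1$. The method EERK3-2 with abscissas $c_2,c_3$ has the coefficients, with $\gamma=\frac{(3c_3-2)c_3}{(2-3c_2)c_2}$, $$a_{21}(z)=c_2\varphi_1(c_2z),\quad a_{32}(z)=\gamma c_2\varphi_2(c_2z)+\tfrac{c_3^2}{c_2}\varphi_2(c_3z),\quad a_{31}(z)=c_3\varphi_1(c_3z)-a_{32}(z),$$ $$a_{42}(z)=\tfrac{\gamma}{\gamma c_2+c_3}\varphi_2(z),\quad a_{43}(z)=\tfrac{1}{\gamma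 c_2+c_3}\varphi_2(z),\quad a_{41}(z)=\varphi_1(z)-a_{42}(z)-a_{43}(z).$$ With step sizes $\tau=\tau_n>0$ (arbitrary, possibly variable), it computes $u^n$ from $u^{n-1}$ for $n\ge1$ by $U^{n,1}=u^{n-1}$, $$U^{n,i+1}=U^{n,1}+\sum_{j=1}^{i}a_{i+1,j}(-\tau L_\kappa)\bigl[\tau g_\kappa(U^{n,j})-\tau L_\kappa U^{n,1}\bigr]\quad(1\le i\le3),\qquad u^n=U^{n,4}.$$ Define the difference coefficients $\underline a_{i+1,i}=a_{i+1,i}$ and $\underline a_{i+1,j}=a_{i+1,j}-a_{i,j}$ for $j<i$, the kernels $\underline\theta_{k,k}=1/\underline a_{k+1,k}$ and $\underline\theta_{k,j}=-\sum_{\ell=j+1}^{k}\underline\theta_{k,\ell}\,\underline a_{\ell+1,j}/\underline a_{j+1,j}$ for $j<k$, and the lower triangular differentiation matrix $D(z)=(d_{k\ell}(z))_{3\times3}$ by $d_{k\ell}(z)=\underline\theta_{k\ell}(z)+\frac z2(2-\delta_{k\ell})$ for $\ell\le k$ and $d_{k\ell}=0$ for $\ell>k$. Write $\delta_\tau U^{n,k+1}=U^{n,k+1}-U^{n,k}$.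 Take $c_2=\frac12$ and $c_3=\frac7{10}$. Then the symmetric part $\frac12(D(z)+D(z)^T)$ is positive definite for every $z<0$, and the method preserves the energy dissipation law at all stages without any time-step restriction: for all $n\ge1$ and $1\le j\le3$, $$E[U^{n,j+1}]-E[U^{n,1}]\le-\frac1\tau\sum_{k=1}^{j}\Bigl\langle\delta_\tau U^{n,k+1},\sum_{\ell=1}^{k}d_{k\ell}(-\tau L_\kappa)\,\delta_\tau U^{n,\ell+1}\Bigr\rangle,$$ where the sum over $k$ on the right is nonnegative; in particular $E[U^{n,j+1}]\le E[U^{n,1}]$. -/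

import Mathlib

noncomputable section

namespace EERK

/-- The entire functions `φ₀(z) = e^z`, `φ_j(z) = ∫₀¹ e^{(1-s)z} s^{j-1}/(j-1)! ds` for `j ≥ 1`,
on the real line. -/
def phi (j : ℕ) (z : ℝ) : ℝ :=
  match j with
  | 0 => Real.exp z
  | m + 1 => ∫ s in (0 : ℝ)..1, Real.exp ((1 - s) * z) * (s ^ m / (Nat.factorial m : ℝ))

/-! Coefficient functions are indexed from 1: `a i j z` stands for `a_{i,j}(z)` with
`1 ≤ j < i ≤ s + 1`, and the weights are the last row, `b_j = a_{s+1,j}`. -/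

/-- `diffCoeff a i j` is the difference coefficient of index `(i+1, j)`: it is `a_{i+1,i}` for
`j = i` and `a_{i+1,j} - a_{i,j}` for `j ≤ i - 1`. -/
def diffCoeff (a : ℕ → ℕ → ℝ → ℝ) (i j : ℕ) (z : ℝ) : ℝ :=
  if j = i then a (i + 1) i z else a (i + 1) j z - a i j z

/-- The discrete orthogonal convolution (DOC) kernels `θ_{k,j}(z)`, by downward recursion on `j`;
they vanish for `j > k`. -/
def docKernel (a : ℕ → ℕ → ℝ → ℝ) (z : ℝ) (k j : ℕ) : ℝ :=
  if j < k then
    -∑ l : {l // l ∈ Finset.Icc (j + 1) k},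
      docKernel a z k l.1 * (diffCoeff a l.1 j z / diffCoeff a j j z)
  else if j = k then 1 / diffCoeff a k k z
  else 0
termination_by k - j
decreasing_by
  have h := Finset.mem_Icc.mp l.2
  omega

/-- The entries `d_{k,l}(z)` of the differentiation matrix. -/
def diffEntry (a : ℕ → ℕ → ℝ → ℝ) (k l : ℕ) (z : ℝ) : ℝ :=
  if l ≤ k then docKernel a z k l + z / 2 * (2 - if k = l then 1 else 0) else 0

/-- The (lower triangular) differentiation matrix `D(z)` of an `s`-stage method. -/
def diffMatrix (a : ℕ → ℕ → ℝ → ℝ) (s : ℕ) (z : ℝ) : Matrix (Fin s) (Fin s) ℝ :=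
  Matrix.of fun k l => diffEntry a (k.1 + 1) (l.1 + 1) z

/-- The symmetric part of a square matrix. -/
def symmPart {s : ℕ} (D : Matrix (Fin s) (Fin s) ℝ) : Matrix (Fin s) (Fin s) ℝ :=
  (1 / 2 : ℝ) • (D + D.transpose)

/-- The parameter `γ` of the two-parameter EERK3-2 family. -/
def gammaParam (c₂ c₃ : ℝ) : ℝ := (3 * c₃ - 2) * c₃ / ((2 - 3 * c₂) * c₂)

/-- The Butcher tableau of the two-parameter, three-stage method EERK3-2. -/
def eerk32 (c₂ c₃ : ℝ) : ℕ → ℕ → ℝ → ℝ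
  | 2, 1, z => c₂ * phi 1 (c₂ * z)
  | 3, 1, z => c₃ * phi 1 (c₃ * z) -
      (gammaParam c₂ c₃ * c₂ * phi 2 (c₂ * z) + c₃ ^ 2 / c₂ * phi 2 (c₃ * z))
  | 3, 2, z => gammaParam c₂ c₃ * c₂ * phi 2 (c₂ * z) + c₃ ^ 2 / c₂ * phi 2 (c₃ * z)
  | 4, 1, z => phi 1 z - gammaParam c₂ c₃ / (gammaParam c₂ c₃ * c₂ + c₃) * phi 2 z -
      1 / (gammaParam c₂ c₃ * c₂ + c₃) * phi 2 z
  | 4, 2, z => gammaParam c₂ c₃ / (gammaParam c₂ c₃ * c₂ + c₃) * phi 2 z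
  | 4, 3, z => 1 / (gammaParam c₂ c₃ * c₂ + c₃) * phi 2 z
  | _, _, _ => 0

variable {ι : Type*} [Fintype ι] [DecidableEq ι]

/-- Action of a real square matrix on `ℝ^ι` with the inner product `⟨u, v⟩ = vᵀ u`. -/
def act (M : Matrix ι ι ℝ) (v : EuclideanSpace ℝ ι) : EuclideanSpace ℝ ι :=
  Matrix.toEuclideanLin M v

/-- The energy `E[v] = ½ ⟨v, L v⟩ + ⟨G(v), 1⟩`. -/
def energy (L : Matrix ι ι ℝ) (G : EuclideanSpace ℝ ι → ι → ℝ) (v : EuclideanSpace ℝ ι) : ℝ :=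
  1 / 2 * inner ℝ v (act L v) + ∑ i, G v i

/-- The stabilized operator `L_κ = L + κ I`. -/
def stabL (L : Matrix ι ι ℝ) (κ : ℝ) : Matrix ι ι ℝ := L + κ • (1 : Matrix ι ι ℝ)

/-- The stabilized nonlinearity `g_κ(u) = g(u) + κ u`. -/
def stabG (g : EuclideanSpace ℝ ι → EuclideanSpace ℝ ι) (κ : ℝ) (u : EuclideanSpace ℝ ι) :
    EuclideanSpace ℝ ι := g u + κ • u

/-- The matrix function `f(-τ L_κ)` applied to a vector; `cfc` is the functional calculus of
symmetric matrices (`f` acts on the eigenvalues). -/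
def matFun (L : Matrix ι ι ℝ) (κ τ : ℝ) (f : ℝ → ℝ) (v : EuclideanSpace ℝ ι) :
    EuclideanSpace ℝ ι :=
  act (cfc f (-(τ • stabL L κ))) v

/-- `U 1, …, U (s+1)` are the stages of one step, of size `τ`, of the `s`-stage EERK method with
coefficients `a`, applied to the stabilized problem `u' = -L_κ u + g_κ(u)`:
`U_{i+1} = U_1 + ∑_{j=1}^{i} a_{i+1,j}(-τ L_κ) (τ g_κ(U_j) - τ L_κ U_1)` for `1 ≤ i ≤ s`. -/
def IsStep (a : ℕ → ℕ → ℝ → ℝ) (s : ℕ) (L : Matrix ι ι ℝ)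
    (g : EuclideanSpace ℝ ι → EuclideanSpace ℝ ι) (κ τ : ℝ) (U : ℕ → EuclideanSpace ℝ ι) : Prop :=
  ∀ i ∈ Finset.Icc 1 s, U (i + 1) = U 1 + ∑ j ∈ Finset.Icc 1 i,
    matFun L κ τ (a (i + 1) j) (τ • stabG g κ (U j) - τ • act (stabL L κ) (U 1))

/-- `u` is the numerical solution, with step sizes `τ n` and stages `U n i`:
`U^{n,1} = u^{n-1}` and `u^n = U^{n,s+1}`. -/
def IsSolution (a : ℕ → ℕ → ℝ → ℝ) (s : ℕ) (L : Matrix ι ι ℝ)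
    (g : EuclideanSpace ℝ ι → EuclideanSpace ℝ ι) (κ : ℝ) (τ : ℕ → ℝ)
    (u : ℕ → EuclideanSpace ℝ ι) (U : ℕ → ℕ → EuclideanSpace ℝ ι) : Prop :=
  ∀ n, 1 ≤ n → U n 1 = u (n - 1) ∧ IsStep a s L g κ (τ n) (U n) ∧ u n = U n (s + 1)

/-- The quadratic form
`∑_{k=1}^{j} ⟨δU_{k+1}, ∑_{l=1}^{k} d_{k,l}(-τ L_κ) δU_{l+1}⟩` with `δU_{i+1} = U_{i+1} - U_i`. -/
def dissipation (a : ℕ → ℕ → ℝ → ℝ) (L : Matrix ι ι ℝ) (κ τ : ℝ)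
    (U : ℕ → EuclideanSpace ℝ ι) (j : ℕ) : ℝ :=
  ∑ k ∈ Finset.Icc 1 j, inner ℝ (U (k + 1) - U k)
    (∑ l ∈ Finset.Icc 1 k, matFun L κ τ (diffEntry a k l) (U (l + 1) - U l))

end EERK

end

/-!
In an eigenbasis of `L_κ` one step of the method decouples into scalar recursions with coefficients
`a_{i,j}(z)`, `z < 0`. The DOC kernels form the inverse of the lower triangular matrix `A(z)` of the
difference coefficients, and the remaining terms of `D(z)` sum the increments up to the midpoint of
the stage; hence `∑_l d_{k,l}(-τ L_κ) δU_{l+1} = τ (g_κ(U_k) - L_κ (U_k + δU_{k+1} / 2))`. By the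
descent lemma for the `ℓ`-Lipschitz gradient of `⟨G, 1⟩`, the energy increment of the stage is at
most `-1 / τ` times the inner product of this vector with `δU_{k+1}`.

For the positive definiteness, `A(z)` is a congruence from the symmetric part of `D(z)` to the
symmetric part of `A(z)` plus `(z / 2) b bᵀ`, where `b`, the vector of column sums of `A(z)`, is the
last row of the tableau. At `z = -10 t` the tableau only involves the exponentials
`exp (-5 t)`, `exp (-7 t)` and `exp (-10 t)`, and the trailing minors of orders two and three are,
up to positive factors, exponential polynomials in `t`. Their Taylor coefficients at `0` are
nonnegative: the terms of the largest rate dominate from the hundredth coefficient on, and the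
coefficients before are integers that can be computed.
-/

noncomputable section

namespace EERK

theorem sum_Icc_one_sub {M : Type*} [AddCommGroup M] (f : ℕ → M) (n : ℕ) :
    ∑ k ∈ Finset.Icc 1 n, (f (k + 1) - f k) = f (n + 1) - f 1 :=
  Finset.sum_Ico_sub f (Nat.le_add_left 1 n)

theorem sum_fin_succ_eq_sum_Icc {M : Type*} [AddCommMonoid M] (f : ℕ → M) (n : ℕ) :
    ∑ k : Fin n, f (k + 1) = ∑ k ∈ Finset.Icc 1 n, f k := by
  rw [Fin.sum_univ_eq_sum_range (fun k => f (k + 1)), Finset.range_eq_Ico,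
    Finset.sum_Ico_add' f 0 n 1]
  rfl

section DocKernel

variable {a : ℕ → ℕ → ℝ → ℝ} {z : ℝ}

theorem diffCoeff_self (a : ℕ → ℕ → ℝ → ℝ) (k : ℕ) (z : ℝ) :
    diffCoeff a k k z = a (k + 1) k z :=
  if_pos rfl

theorem diffCoeff_of_lt (a : ℕ → ℕ → ℝ → ℝ) {k j : ℕ} (h : j < k) (z : ℝ) :
    diffCoeff a k j z = a (k + 1) j z - a k j z :=
  if_neg h.ne

theorem docKernel_self (k : ℕ) : docKernel a z k k = 1 / a (k + 1) k z := by
  rw [docKernel, if_neg (lt_irrefl k), if_pos rfl, diffCoeff_self]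

theorem docKernel_of_lt {k j : ℕ} (h : k < j) : docKernel a z k j = 0 := by
  rw [docKernel, if_neg h.not_gt, if_neg h.ne']

theorem sum_docKernel_mul_diffCoeff {j k : ℕ} (hj : a (j + 1) j z ≠ 0) :
    ∑ l ∈ Finset.Icc j k, docKernel a z k l * diffCoeff a l j z = if k = j then 1 else 0 := by
  rcases lt_trichotomy j k with h | rfl | h
  · have hrec : docKernel a z k j =
        -∑ l ∈ Finset.Ioc j k, docKernel a z k l * (diffCoeff a l j z / a (j + 1) j z) := by
      rw [docKernel, if_pos h, Finset.sum_coe_sort (Finset.Icc (j + 1) k)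
        (fun l => docKernel a z k l * (diffCoeff a l j z / diffCoeff a j j z)), diffCoeff_self,
        Finset.Icc_add_one_left_eq_Ioc]
    rw [← Finset.add_sum_Ioc_eq_sum_Icc h.le, hrec, if_neg h.ne', neg_mul, Finset.sum_mul,
      neg_add_eq_zero, diffCoeff_self]
    exact Finset.sum_congr rfl fun l _ => by field_simp
  · simp [docKernel_self, diffCoeff_self, hj]
  · rw [Finset.Icc_eq_empty h.not_ge, Finset.sum_empty, if_neg h.ne]

theorem sum_docKernel_mul {k : ℕ} (hk : 1 ≤ k) {v V : ℕ → ℝ}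
    (ha : ∀ j ∈ Finset.Icc 1 k, a (j + 1) j z ≠ 0)
    (hv : ∀ l ∈ Finset.Icc 1 k, v l = ∑ j ∈ Finset.Icc 1 l, diffCoeff a l j z * V j) :
    ∑ l ∈ Finset.Icc 1 k, docKernel a z k l * v l = V k := by
  calc ∑ l ∈ Finset.Icc 1 k, docKernel a z k l * v l
      = ∑ l ∈ Finset.Icc 1 k, ∑ j ∈ Finset.Icc 1 l,
          docKernel a z k l * diffCoeff a l j z * V j := by
        refine Finset.sum_congr rfl fun l hl => ?_
        rw [hv l hl, Finset.mul_sum]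
        simp only [mul_assoc]
    _ = ∑ j ∈ Finset.Icc 1 k, ∑ l ∈ Finset.Icc j k,
          docKernel a z k l * diffCoeff a l j z * V j := by
        refine Finset.sum_comm' fun l j => ?_
        simp only [Finset.mem_Icc]
        omega
    _ = ∑ j ∈ Finset.Icc 1 k, (if k = j then 1 else 0) * V j := by
        refine Finset.sum_congr rfl fun j hj => ?_
        rw [← Finset.sum_mul, sum_docKernel_mul_diffCoeff (ha j hj)]
    _ = V k := by simp [hk]

theorem sum_diffEntry_mul {k : ℕ} (hk : 1 ≤ k) {v V : ℕ → ℝ}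
    (ha : ∀ j ∈ Finset.Icc 1 k, a (j + 1) j z ≠ 0)
    (hv : ∀ l ∈ Finset.Icc 1 k, v l = ∑ j ∈ Finset.Icc 1 l, diffCoeff a l j z * V j) :
    ∑ l ∈ Finset.Icc 1 k, diffEntry a k l z * v l =
      V k + z * ∑ l ∈ Finset.Icc 1 k, v l - z / 2 * v k := by
  have hentry : ∀ l ∈ Finset.Icc 1 k, diffEntry a k l z * v l =
      docKernel a z k l * v l + (z * v l - z / 2 * if k = l then v l else 0) := by
    intro l hl
    rw [diffEntry, if_pos (Finset.mem_Icc.mp hl).2]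
    split_ifs <;> ring
  rw [Finset.sum_congr rfl hentry, Finset.sum_add_distrib, sum_docKernel_mul hk ha hv,
    Finset.sum_sub_distrib, ← Finset.mul_sum, ← Finset.mul_sum, Finset.sum_ite_eq,
    if_pos (Finset.mem_Icc.mpr ⟨hk, le_rfl⟩)]
  ring

theorem sum_Icc_diffCoeff (a : ℕ → ℕ → ℝ → ℝ) {j s : ℕ} (hjs : j ≤ s) (z : ℝ) :
    ∑ l ∈ Finset.Icc j s, diffCoeff a l j z = a (s + 1) j z := by
  induction s, hjs using Nat.le_induction with
  | base => rw [Finset.Icc_self, Finset.sum_singleton, diffCoeff_self]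
  | succ s hjs ih =>
    rw [Finset.sum_Icc_succ_top (by omega), ih, diffCoeff_of_lt a (by omega), add_sub_cancel]

end DocKernel

section DiffMatrix

open scoped Matrix

variable {s : ℕ}

theorem isHermitian_symmPart (D : Matrix (Fin s) (Fin s) ℝ) : (symmPart D).IsHermitian := by
  rw [Matrix.IsHermitian, Matrix.conjTranspose_eq_transpose_of_trivial, symmPart,
    Matrix.transpose_smul, Matrix.transpose_add, Matrix.transpose_transpose, add_comm]

theorem symmPart_transpose (D : Matrix (Fin s) (Fin s) ℝ) : symmPart Dᵀ = symmPart D := by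
  rw [symmPart, symmPart, Matrix.transpose_transpose, add_comm]

theorem symmPart_transpose_mul_mul (D A : Matrix (Fin s) (Fin s) ℝ) :
    symmPart (Aᵀ * D * A) = Aᵀ * symmPart D * A := by
  simp only [symmPart, Matrix.transpose_mul, Matrix.transpose_transpose, Matrix.mul_smul,
    Matrix.smul_mul, Matrix.mul_add, Matrix.add_mul, Matrix.mul_assoc]

theorem dotProduct_symmPart_mulVec (D : Matrix (Fin s) (Fin s) ℝ) (x : Fin s → ℝ) :
    x ⬝ᵥ symmPart D *ᵥ x = x ⬝ᵥ D *ᵥ x := by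
  rw [symmPart, Matrix.smul_mulVec, Matrix.add_mulVec, Matrix.mulVec_transpose, dotProduct_smul,
    dotProduct_add, dotProduct_comm x (x ᵥ* D), ← Matrix.dotProduct_mulVec, smul_eq_mul]
  ring

theorem dotProduct_diffMatrix_mulVec_nonneg {a : ℕ → ℕ → ℝ → ℝ} {z : ℝ}
    (hD : (symmPart (diffMatrix a s z)).PosSemidef) {j : ℕ} (hj : j ≤ s) (x : Fin j → ℝ) :
    0 ≤ x ⬝ᵥ diffMatrix a j z *ᵥ x := by
  have hsub : (symmPart (diffMatrix a j z)).PosSemidef := hD.submatrix (Fin.castLE hj)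
  rw [← dotProduct_symmPart_mulVec]
  exact hsub.dotProduct_mulVec_nonneg x

theorem dotProduct_diffMatrix_mulVec (a : ℕ → ℕ → ℝ → ℝ) (z : ℝ) (v : ℕ → ℝ) :
    (fun k : Fin s => v (k + 1)) ⬝ᵥ diffMatrix a s z *ᵥ (fun k : Fin s => v (k + 1)) =
      ∑ k ∈ Finset.Icc 1 s, v k * ∑ l ∈ Finset.Icc 1 k, diffEntry a k l z * v l := by
  have hrow : ∀ k ∈ Finset.Icc 1 s, ∑ l ∈ Finset.Icc 1 k, diffEntry a k l z * v l =
      ∑ l : Fin s, diffEntry a k (l + 1) z * v (l + 1) := by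
    intro k hk
    rw [sum_fin_succ_eq_sum_Icc fun l => diffEntry a k l z * v l]
    refine Finset.sum_subset (Finset.Icc_subset_Icc_right (Finset.mem_Icc.mp hk).2)
      fun l hl hlk => ?_
    rw [diffEntry, if_neg (by simp only [Finset.mem_Icc] at hl hlk; omega), zero_mul]
  rw [Finset.sum_congr rfl fun k hk => by rw [hrow k hk], ← sum_fin_succ_eq_sum_Icc]
  rfl

/-- The lower triangular matrix of the difference coefficients of an `s`-stage method. -/
def diffCoeffMatrix (a : ℕ → ℕ → ℝ → ℝ) (s : ℕ) (z : ℝ) : Matrix (Fin s) (Fin s) ℝ :=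
  Matrix.of fun k l => if l ≤ k then diffCoeff a (k + 1) (l + 1) z else 0

/-- The lower triangular matrix of the DOC kernels of an `s`-stage method. -/
def docMatrix (a : ℕ → ℕ → ℝ → ℝ) (s : ℕ) (z : ℝ) : Matrix (Fin s) (Fin s) ℝ :=
  Matrix.of fun k l => docKernel a z (k + 1) (l + 1)

/-- The last row `b` of the coefficient table of an `s`-stage method. -/
def weights (a : ℕ → ℕ → ℝ → ℝ) (s : ℕ) (z : ℝ) : Fin s → ℝ :=
  fun j => a (s + 1) (j + 1) z

variable {a : ℕ → ℕ → ℝ → ℝ} {z : ℝ}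

theorem docMatrix_mul_diffCoeffMatrix (ha : ∀ j ∈ Finset.Icc 1 s, a (j + 1) j z ≠ 0) :
    docMatrix a s z * diffCoeffMatrix a s z = 1 := by
  ext i j
  have hfin : ∀ l : Fin s, docMatrix a s z i l * diffCoeffMatrix a s z l j =
      docKernel a z (i + 1) (l + 1) *
        if (j : ℕ) + 1 ≤ l + 1 then diffCoeff a (l + 1) (j + 1) z else 0 := by
    intro l
    simp only [docMatrix, diffCoeffMatrix, Matrix.of_apply, Nat.add_le_add_iff_right,
      Fin.val_fin_le]
  rw [Matrix.mul_apply, Finset.sum_congr rfl fun l _ => hfin l,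
    sum_fin_succ_eq_sum_Icc fun l => docKernel a z (i + 1) l *
      if (j : ℕ) + 1 ≤ l then diffCoeff a l (j + 1) z else 0]
  have hsub : Finset.Icc (j + 1 : ℕ) (i + 1) ⊆ Finset.Icc 1 s :=
    Finset.Icc_subset_Icc (by omega) (by omega)
  rw [← Finset.sum_subset hsub, Finset.sum_congr rfl fun l hl => by
      rw [if_pos (Finset.mem_Icc.mp hl).1],
    sum_docKernel_mul_diffCoeff (ha _ (Finset.mem_Icc.mpr ⟨by omega, by omega⟩)),
    Matrix.one_apply]
  · simp only [Nat.add_right_cancel_iff, Fin.ext_iff]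
  · intro l _ hl
    rcases lt_or_ge (i + 1 : ℕ) l with h | h
    · rw [docKernel_of_lt h, zero_mul]
    · rw [if_neg (by simp only [Finset.mem_Icc] at hl; omega), mul_zero]

theorem one_vecMul_diffCoeffMatrix : 1 ᵥ* diffCoeffMatrix a s z = weights a s z := by
  ext j
  have hfin : ∀ l : Fin s, diffCoeffMatrix a s z l j =
      if (j : ℕ) + 1 ≤ l + 1 then diffCoeff a (l + 1) (j + 1) z else 0 := by
    intro l
    simp only [diffCoeffMatrix, Matrix.of_apply, Nat.add_le_add_iff_right, Fin.val_fin_le]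
  have hfilter : (Finset.Icc 1 s).filter ((j : ℕ) + 1 ≤ ·) = Finset.Icc (j + 1 : ℕ) s := by
    ext l
    simp only [Finset.mem_filter, Finset.mem_Icc]
    omega
  rw [Matrix.vecMul, one_dotProduct, Finset.sum_congr rfl fun l _ => hfin l,
    sum_fin_succ_eq_sum_Icc fun l => if (j : ℕ) + 1 ≤ l then diffCoeff a l (j + 1) z else 0,
    ← Finset.sum_filter, hfilter, sum_Icc_diffCoeff a j.isLt, weights]

theorem symmPart_diffMatrix :
    symmPart (diffMatrix a s z) =
      symmPart (docMatrix a s z) + (z / 2) • Matrix.vecMulVec 1 1 := by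
  ext k l
  simp only [symmPart, diffMatrix, docMatrix, diffEntry, Matrix.smul_apply, Matrix.add_apply,
    Matrix.transpose_apply, Matrix.of_apply, Matrix.vecMulVec_apply, Pi.one_apply, smul_eq_mul]
  rcases lt_trichotomy (k + 1 : ℕ) (l + 1) with h | h | h
  · rw [if_neg h.not_ge, if_pos h.le, if_neg h.ne', docKernel_of_lt h]
    ring
  · rw [h, if_pos le_rfl, if_pos rfl]
    ring
  · rw [if_pos h.le, if_neg h.not_ge, if_neg h.ne', docKernel_of_lt h]
    ring

theorem transpose_mul_symmPart_diffMatrix_mul (ha : ∀ j ∈ Finset.Icc 1 s, a (j + 1) j z ≠ 0) :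
    (diffCoeffMatrix a s z)ᵀ * symmPart (diffMatrix a s z) * diffCoeffMatrix a s z =
      symmPart (diffCoeffMatrix a s z) +
        (z / 2) • Matrix.vecMulVec (weights a s z) (weights a s z) := by
  rw [symmPart_diffMatrix, Matrix.mul_add, Matrix.add_mul, ← symmPart_transpose_mul_mul,
    Matrix.mul_assoc _ (docMatrix a s z), docMatrix_mul_diffCoeffMatrix ha, Matrix.mul_one,
    symmPart_transpose, Matrix.mul_smul, Matrix.smul_mul, Matrix.mul_vecMulVec,
    Matrix.vecMulVec_mul, Matrix.mulVec_transpose, one_vecMul_diffCoeffMatrix]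

theorem posDef_symmPart_diffMatrix_iff (ha : ∀ j ∈ Finset.Icc 1 s, a (j + 1) j z ≠ 0) :
    (symmPart (diffMatrix a s z)).PosDef ↔
      (symmPart (diffCoeffMatrix a s z) +
        (z / 2) • Matrix.vecMulVec (weights a s z) (weights a s z)).PosDef := by
  have hunit : IsUnit (diffCoeffMatrix a s z) :=
    .of_mul_eq_one_right _ (docMatrix_mul_diffCoeffMatrix ha)
  rw [← Matrix.IsUnit.posDef_star_left_conjugate_iff hunit, Matrix.star_eq_conjTranspose,
    Matrix.conjTranspose_eq_transpose_of_trivial, transpose_mul_symmPart_diffMatrix_mul ha]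

end DiffMatrix

section Spectral

variable {ι : Type*} [Fintype ι] [DecidableEq ι]

theorem act_add (M : Matrix ι ι ℝ) (v w : EuclideanSpace ℝ ι) :
    act M (v + w) = act M v + act M w :=
  map_add _ v w

theorem act_smul (M : Matrix ι ι ℝ) (c : ℝ) (v : EuclideanSpace ℝ ι) :
    act M (c • v) = c • act M v :=
  map_smul _ c v

theorem act_neg_smul (M : Matrix ι ι ℝ) (c : ℝ) (v : EuclideanSpace ℝ ι) :
    act (-(c • M)) v = -(c • act M v) := by
  simp [act]

theorem act_stabL (L : Matrix ι ι ℝ) (κ : ℝ) (v : EuclideanSpace ℝ ι) :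
    act (stabL L κ) v = act L v + κ • v := by
  simp [act, stabL]

theorem inner_act_comm {M : Matrix ι ι ℝ} (hM : M.IsHermitian) (v w : EuclideanSpace ℝ ι) :
    inner ℝ v (act M w) = inner ℝ (act M v) w :=
  ((Matrix.isSymmetric_toEuclideanLin_iff.mpr hM) v w).symm

variable {A : Matrix ι ι ℝ}

theorem eigenvalues_neg_of_posDef_neg (hA : A.IsHermitian) (hneg : (-A).PosDef) (i : ι) :
    hA.eigenvalues i < 0 := by
  have hne : (hA.eigenvectorBasis i).ofLp ≠ 0 :=
    (WithLp.ofLp_eq_zero 2).not.mpr (hA.eigenvectorBasis.orthonormal.ne_zero i)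
  have hpos := hneg.dotProduct_mulVec_pos hne
  rw [hA.eigenvalues_eq]
  simpa [Matrix.neg_mulVec] using hpos

theorem act_cfc_eigenvectorBasis (hA : A.IsHermitian) (f : ℝ → ℝ) (i : ι) :
    act (cfc f A) (hA.eigenvectorBasis i) = f (hA.eigenvalues i) • hA.eigenvectorBasis i := by
  have hmulVec : (cfc f A).mulVec (hA.eigenvectorBasis i) =
      f (hA.eigenvalues i) • ⇑(hA.eigenvectorBasis i) := by
    rw [hA.cfc_eq, Matrix.IsHermitian.cfc, Unitary.conjStarAlgAut_apply, ← Matrix.mulVec_mulVec,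
      ← Matrix.mulVec_mulVec, hA.star_eigenvectorUnitary_mulVec,
      Matrix.diagonal_mulVec_single, Matrix.mulVec_single, hA.eigenvectorUnitary_col_eq]
    simp
  ext k
  exact congrFun hmulVec k

theorem inner_eigenvectorBasis_act_cfc (hA : A.IsHermitian) (f : ℝ → ℝ) (i : ι)
    (v : EuclideanSpace ℝ ι) :
    inner ℝ (hA.eigenvectorBasis i) (act (cfc f A) v) =
      f (hA.eigenvalues i) * inner ℝ (hA.eigenvectorBasis i) v := by
  have hcfc : (cfc f A).IsHermitian := cfc_predicate f A
  rw [inner_act_comm hcfc, act_cfc_eigenvectorBasis, real_inner_smul_left]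

theorem inner_eigenvectorBasis_act (hA : A.IsHermitian) (i : ι) (v : EuclideanSpace ℝ ι) :
    inner ℝ (hA.eigenvectorBasis i) (act A v) =
      hA.eigenvalues i * inner ℝ (hA.eigenvectorBasis i) v := by
  have hid := inner_eigenvectorBasis_act_cfc hA id i v
  rwa [cfc_id ℝ A hA.isSelfAdjoint] at hid

end Spectral

section Descent

variable {E : Type*} [NormedAddCommGroup E] [InnerProductSpace ℝ E] {Φ' : E → E} {ℓ : ℝ}

theorem inner_add_smul_le_of_lipschitz (hLip : ∀ u v, ‖Φ' u - Φ' v‖ ≤ ℓ * ‖u - v‖) (u δ : E)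
    {s : ℝ} (hs : 0 ≤ s) :
    inner ℝ (Φ' (u + s • δ)) δ ≤ inner ℝ (Φ' u) δ + ℓ * s * ‖δ‖ ^ 2 := by
  rw [← sub_le_iff_le_add', ← inner_sub_left]
  calc inner ℝ (Φ' (u + s • δ) - Φ' u) δ
      ≤ ‖Φ' (u + s • δ) - Φ' u‖ * ‖δ‖ := real_inner_le_norm _ _
    _ ≤ ℓ * ‖u + s • δ - u‖ * ‖δ‖ := by gcongr; exact hLip _ _
    _ = ℓ * s * ‖δ‖ ^ 2 := by
      rw [add_sub_cancel_left, norm_smul, Real.norm_of_nonneg hs]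
      ring

theorem sub_le_of_hasGradientAt_of_lipschitz [CompleteSpace E] {Φ : E → ℝ}
    (hΦ : ∀ v, HasGradientAt Φ (Φ' v) v) (hLip : ∀ u v, ‖Φ' u - Φ' v‖ ≤ ℓ * ‖u - v‖) (u δ : E) :
    Φ (u + δ) - Φ u ≤ inner ℝ (Φ' u) δ + ℓ / 2 * ‖δ‖ ^ 2 := by
  have hline : ∀ s : ℝ,
      HasDerivAt (fun s : ℝ => Φ (u + s • δ)) (inner ℝ (Φ' (u + s • δ)) δ) s := by
    intro s
    have hpath : HasDerivAt (fun s : ℝ => u + s • δ) δ s := by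
      simpa using ((hasDerivAt_id s).smul_const δ).const_add u
    exact ((hΦ (u + s • δ)).hasFDerivAt.comp_hasDerivAt s hpath).congr_deriv
      (InnerProductSpace.toDual_apply_apply ..)
  have hquad : ∀ s : ℝ, HasDerivAt (fun s : ℝ => inner ℝ (Φ' u) δ * s + ℓ / 2 * ‖δ‖ ^ 2 * s ^ 2)
      (inner ℝ (Φ' u) δ + ℓ * s * ‖δ‖ ^ 2) s := by
    intro s
    refine (((hasDerivAt_id s).const_mul _).add (((hasDerivAt_id s).pow 2).const_mul _)).congr_deriv
      ?_
    simp only [id]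
    ring
  have hanti := antitoneOn_of_hasDerivWithinAt_nonpos (convex_Icc (0 : ℝ) 1)
    (fun s _ => ((hline s).sub (hquad s)).continuousAt.continuousWithinAt)
    (fun s _ => ((hline s).sub (hquad s)).hasDerivWithinAt)
    fun s hs => sub_nonpos.mpr (inner_add_smul_le_of_lipschitz hLip u δ (interior_subset hs).1)
  have hends := hanti (Set.left_mem_Icc.mpr zero_le_one) (Set.right_mem_Icc.mpr zero_le_one)
    zero_le_one
  simp only [Pi.sub_apply, zero_smul, one_smul, add_zero] at hends
  linarith

end Descent

section EnergyLaw

theorem isHermitian_neg_smul_stabL {n : Type*} [DecidableEq n] {L : Matrix n n ℝ} {κ : ℝ}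
    (hL : (stabL L κ).IsHermitian) (τ : ℝ) : (-(τ • stabL L κ)).IsHermitian :=
  (hL.smul (IsSelfAdjoint.all τ)).neg

variable {ι : Type*} [Fintype ι] [DecidableEq ι] {a : ℕ → ℕ → ℝ → ℝ} {s : ℕ} {L : Matrix ι ι ℝ}
  {g : EuclideanSpace ℝ ι → EuclideanSpace ℝ ι} {G : EuclideanSpace ℝ ι → ι → ℝ} {ℓ κ τ : ℝ}
  {U : ℕ → EuclideanSpace ℝ ι}

theorem energy_add_sub_le (hL : L.IsHermitian)
    (hgG : ∀ v, HasGradientAt (fun w => ∑ i, G w i) (-g v) v)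
    (hLip : ∀ u v, ‖g u - g v‖ ≤ ℓ * ‖u - v‖) (hκ : ℓ ≤ κ) (u δ : EuclideanSpace ℝ ι) :
    energy L G (u + δ) - energy L G u ≤
      -inner ℝ δ (stabG g κ u - act (stabL L κ) (u + (1 / 2 : ℝ) • δ)) := by
  have hdescent := sub_le_of_hasGradientAt_of_lipschitz hgG
    (fun u v => by rw [← neg_sub', norm_neg]; exact hLip u v) u δ
  have hsymm : inner ℝ u (act L δ) = inner ℝ δ (act L u) := by
    rw [inner_act_comm hL, real_inner_comm]
  have hstab : ℓ / 2 * ‖δ‖ ^ 2 ≤ κ / 2 * ‖δ‖ ^ 2 := by gcongr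
  rw [inner_neg_left, real_inner_comm] at hdescent
  simp only [energy, stabG, act_stabL, act_add, act_smul, inner_add_left, inner_add_right,
    inner_sub_right, real_inner_smul_right, real_inner_self_eq_norm_sq, smul_add, hsymm]
  linarith

theorem IsStep.inner_eigenvectorBasis_sub (hU : IsStep a s L g κ τ U)
    (hA : (-(τ • stabL L κ)).IsHermitian) (i : ι) {k : ℕ} (hk : k ∈ Finset.Icc 1 s) :
    inner ℝ (hA.eigenvectorBasis i) (U (k + 1) - U k) =
      ∑ j ∈ Finset.Icc 1 k, diffCoeff a k j (hA.eigenvalues i) *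
        inner ℝ (hA.eigenvectorBasis i) (τ • stabG g κ (U j) - τ • act (stabL L κ) (U 1)) := by
  obtain ⟨hk1, hks⟩ := Finset.mem_Icc.mp hk
  obtain ⟨k, rfl⟩ := Nat.exists_eq_add_of_le' hk1
  have hprev : U (k + 1) = U 1 + ∑ j ∈ Finset.Icc 1 k,
      matFun L κ τ (a (k + 1) j) (τ • stabG g κ (U j) - τ • act (stabL L κ) (U 1)) := by
    rcases Nat.eq_zero_or_pos k with rfl | hk0
    · simp
    · exact hU k (Finset.mem_Icc.mpr ⟨hk0, by omega⟩)
  rw [hU (k + 1) hk, hprev, add_sub_add_left_eq_sub, Finset.sum_Icc_succ_top hk1,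
    Finset.sum_Icc_succ_top hk1, inner_sub_right, inner_add_right, inner_sum, inner_sum]
  simp only [matFun, inner_eigenvectorBasis_act_cfc hA]
  rw [add_sub_right_comm, ← Finset.sum_sub_distrib, diffCoeff_self]
  congr 1
  refine Finset.sum_congr rfl fun j hj => ?_
  rw [diffCoeff_of_lt a (Nat.lt_add_one_of_le (Finset.mem_Icc.mp hj).2), sub_mul]

theorem IsStep.sum_matFun_diffEntry (hU : IsStep a s L g κ τ U)
    (hA : (-(τ • stabL L κ)).IsHermitian)
    (ha : ∀ i, ∀ j ∈ Finset.Icc 1 s, a (j + 1) j (hA.eigenvalues i) ≠ 0)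
    {k : ℕ} (hk : k ∈ Finset.Icc 1 s) :
    ∑ l ∈ Finset.Icc 1 k, matFun L κ τ (diffEntry a k l) (U (l + 1) - U l) =
      τ • (stabG g κ (U k) - act (stabL L κ) (U k + (1 / 2 : ℝ) • (U (k + 1) - U k))) := by
  obtain ⟨hk1, hks⟩ := Finset.mem_Icc.mp hk
  have hsub : Finset.Icc 1 k ⊆ Finset.Icc 1 s := Finset.Icc_subset_Icc_right hks
  have hact : ∀ v, τ • act (stabL L κ) v = -act (-(τ • stabL L κ)) v := fun v => by
    rw [act_neg_smul, neg_neg]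
  refine InnerProductSpace.ext_inner_left_basis hA.eigenvectorBasis.toBasis fun i => ?_
  rw [OrthonormalBasis.coe_toBasis, inner_sum]
  simp only [matFun, inner_eigenvectorBasis_act_cfc hA]
  rw [sum_diffEntry_mul hk1 (fun j hj => ha i j (hsub hj))
    (fun l hl => hU.inner_eigenvectorBasis_sub hA i (hsub hl)), ← inner_sum,
    sum_Icc_one_sub U, smul_sub, hact, hact]
  simp only [inner_sub_right, inner_neg_right, inner_eigenvectorBasis_act hA, inner_add_right,
    real_inner_smul_right]
  ring

theorem dissipation_eq_sum_dotProduct (hA : (-(τ • stabL L κ)).IsHermitian) (j : ℕ) :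
    dissipation a L κ τ U j = ∑ i,
      (fun k : Fin j => inner ℝ (hA.eigenvectorBasis i) (U (k + 1 + 1) - U (k + 1))) ⬝ᵥ
        (diffMatrix a j (hA.eigenvalues i)).mulVec
          fun k : Fin j => inner ℝ (hA.eigenvectorBasis i) (U (k + 1 + 1) - U (k + 1)) := by
  rw [Finset.sum_congr rfl fun i _ => dotProduct_diffMatrix_mulVec a (hA.eigenvalues i)
    fun k => inner ℝ (hA.eigenvectorBasis i) (U (k + 1) - U k), Finset.sum_comm, dissipation]
  refine Finset.sum_congr rfl fun k _ => ?_
  rw [← hA.eigenvectorBasis.sum_inner_mul_inner]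
  refine Finset.sum_congr rfl fun i _ => ?_
  rw [real_inner_comm, inner_sum]
  simp only [matFun, inner_eigenvectorBasis_act_cfc hA]

theorem eigenvalues_neg_smul_stabL_neg (hL : (stabL L κ).PosDef) (hτ : 0 < τ)
    (hA : (-(τ • stabL L κ)).IsHermitian) (i : ι) : hA.eigenvalues i < 0 :=
  eigenvalues_neg_of_posDef_neg hA (by rw [neg_neg]; exact hL.smul hτ) i

theorem dissipation_nonneg (hL : (stabL L κ).PosDef) (hτ : 0 < τ)
    (hD : ∀ z < 0, (symmPart (diffMatrix a s z)).PosSemidef) {j : ℕ} (hj : j ≤ s) :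
    0 ≤ dissipation a L κ τ U j := by
  have hA := isHermitian_neg_smul_stabL hL.isHermitian τ
  rw [dissipation_eq_sum_dotProduct hA]
  exact Finset.sum_nonneg fun i _ => dotProduct_diffMatrix_mulVec_nonneg
    (hD _ (eigenvalues_neg_smul_stabL_neg hL hτ hA i)) hj _

theorem IsStep.energy_sub_le (hU : IsStep a s L g κ τ U) (hL : (stabL L κ).PosDef)
    (hgG : ∀ v, HasGradientAt (fun w => ∑ i, G w i) (-g v) v)
    (hLip : ∀ u v, ‖g u - g v‖ ≤ ℓ * ‖u - v‖) (hκ : ℓ ≤ κ) (hτ : 0 < τ)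
    (ha : ∀ z < 0, ∀ j ∈ Finset.Icc 1 s, a (j + 1) j z ≠ 0) {j : ℕ} (hj : j ≤ s) :
    energy L G (U (j + 1)) - energy L G (U 1) ≤ -(1 / τ) * dissipation a L κ τ U j := by
  have hA := isHermitian_neg_smul_stabL hL.isHermitian τ
  have hLherm : L.IsHermitian := by
    simpa [stabL] using hL.isHermitian.sub
      (Matrix.isHermitian_one.smul (IsSelfAdjoint.all κ))
  rw [← sum_Icc_one_sub fun k => energy L G (U k), dissipation, Finset.mul_sum]
  refine Finset.sum_le_sum fun k hk => ?_
  have hstage := energy_add_sub_le hLherm hgG hLip hκ (U k) (U (k + 1) - U k)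
  rw [hU.sum_matFun_diffEntry hA (fun i => ha _ (eigenvalues_neg_smul_stabL_neg hL hτ hA i))
    (Finset.Icc_subset_Icc_right hj hk), real_inner_smul_right, ← mul_assoc, neg_mul,
    one_div_mul_cancel hτ.ne', neg_one_mul]
  rwa [add_sub_cancel] at hstage

end EnergyLaw

theorem posDef_fin_three {M : Matrix (Fin 3) (Fin 3) ℝ} (hM : M.IsHermitian) (hcorner : 0 < M 2 2)
    (hminor : 0 < M 1 1 * M 2 2 - M 1 2 * M 2 1) (hdet : 0 < M.det) : M.PosDef := by
  refine .of_dotProduct_mulVec_pos hM fun x hx => ?_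
  have h01 : M 0 1 = M 1 0 := hM.apply 1 0
  have h02 : M 0 2 = M 2 0 := hM.apply 2 0
  have h12 : M 1 2 = M 2 1 := hM.apply 2 1
  set m := M 1 1 * M 2 2 - M 1 2 * M 2 1 with hm
  have hsquares : M 2 2 * m * (star x ⬝ᵥ M.mulVec x) =
      m * (M 2 0 * x 0 + M 2 1 * x 1 + M 2 2 * x 2) ^ 2 +
        (m * x 1 + (M 1 0 * M 2 2 - M 2 0 * M 2 1) * x 0) ^ 2 + M 2 2 * M.det * x 0 ^ 2 := by
    rw [Matrix.det_fin_three, star_trivial, hm]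
    simp only [dotProduct, Matrix.mulVec, Fin.sum_univ_three, h01, h02, h12]
    ring
  refine pos_of_mul_pos_right (hsquares ▸ ?_) (mul_pos hcorner hminor).le
  by_cases h0 : x 0 = 0
  · by_cases h1 : x 1 = 0
    · have h2 : x 2 ≠ 0 := fun h2 => hx (by ext i; fin_cases i <;> assumption)
      simp only [h0, h1, mul_zero, zero_add, add_zero]
      positivity
    · simp only [h0, mul_zero, add_zero]
      positivity
  · positivity

section ExpPoly

/-- The exponential monomial `coeff * t ^ deg * exp (rate * t)`. -/
structure ExpMonomial where
  coeff : ℤ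
  deg : ℕ
  rate : ℕ

/-- The exponential polynomial with the given list of monomials. -/
def expPoly (p : List ExpMonomial) (t : ℝ) : ℝ :=
  (p.map fun e => (e.coeff : ℝ) * (t ^ e.deg * Real.exp (e.rate * t))).sum

/-- The `n`-th derivative at `0` of `expPoly p`, an integer that can be computed. -/
def taylorCoeff (p : List ExpMonomial) (n : ℕ) : ℤ :=
  (p.map fun e => e.coeff * ((n.descFactorial e.deg * e.rate ^ (n - e.deg) : ℕ) : ℤ)).sum

theorem hasSum_pow_mul_exp (d k : ℕ) (t : ℝ) :
    HasSum (fun n : ℕ => ((n.descFactorial d * k ^ (n - d) : ℕ) : ℝ) * (t ^ n / n.factorial))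
      (t ^ d * Real.exp (k * t)) := by
  rw [← hasSum_nat_add_iff' d, Finset.sum_eq_zero, sub_zero]
  · have hexp := (NormedSpace.expSeries_div_hasSum_exp ((k : ℝ) * t)).mul_left (t ^ d)
    rw [← Real.exp_eq_exp_ℝ] at hexp
    refine hexp.congr_fun fun n => ?_
    have hfact : (n.factorial : ℝ) * ((n + d).descFactorial d : ℝ) = (n + d).factorial := by
      have hnat := Nat.factorial_mul_descFactorial (Nat.le_add_left d n)
      rw [Nat.add_sub_cancel] at hnat
      exact_mod_cast hnat
    have hdesc : ((n + d).descFactorial d : ℝ) ≠ 0 :=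
      right_ne_zero_of_mul (hfact ▸ Nat.cast_ne_zero.mpr (n + d).factorial_ne_zero)
    rw [Nat.add_sub_cancel, ← hfact]
    push_cast
    field_simp
    ring
  · intro n hn
    rw [Nat.descFactorial_of_lt (Finset.mem_range.mp hn), zero_mul, Nat.cast_zero, zero_mul]

theorem hasSum_expPoly (p : List ExpMonomial) (t : ℝ) :
    HasSum (fun n : ℕ => (taylorCoeff p n : ℝ) * (t ^ n / n.factorial)) (expPoly p t) := by
  induction p with
  | nil => simp [taylorCoeff, expPoly, hasSum_zero]
  | cons e p ih =>
    have hcons := ((hasSum_pow_mul_exp e.deg e.rate t).mul_left (e.coeff : ℝ)).add ih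
    simp only [taylorCoeff, expPoly, List.map_cons, List.sum_cons] at hcons ⊢
    refine hcons.congr_fun fun n => ?_
    push_cast
    ring

theorem expPoly_pos {p : List ExpMonomial} (hp : ∀ n, 0 ≤ taylorCoeff p n) {m : ℕ}
    (hm : 0 < taylorCoeff p m) {t : ℝ} (ht : 0 < t) : 0 < expPoly p t := by
  have hsum := hasSum_expPoly p t
  rw [← hsum.tsum_eq]
  refine hsum.summable.tsum_pos (fun n => ?_) m (by positivity)
  have := hp n
  positivity

theorem expPoly_eq_exp_mul {p : List ExpMonomial} {M : ℕ} (hp : ∀ e ∈ p, e.rate ≤ M) (t : ℝ) :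
    expPoly p t = Real.exp (M * t) *
      (p.map fun e => (e.coeff : ℝ) * (t ^ e.deg * Real.exp (-t) ^ (M - e.rate))).sum := by
  rw [expPoly, ← List.sum_map_mul_left]
  refine congrArg List.sum (List.map_congr_left fun e he => ?_)
  rw [← Real.exp_nat_mul, Nat.cast_sub (hp e he),
    show (e.rate : ℝ) * t = M * t + ((M : ℝ) - e.rate) * -t by ring, Real.exp_add]
  ring

theorem taylorCoeff_append (p q : List ExpMonomial) (n : ℕ) :
    taylorCoeff (p ++ q) n = taylorCoeff p n + taylorCoeff q n := by
  simp [taylorCoeff]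

theorem abs_taylorCoeff_le {p : List ExpMonomial} {d K : ℕ}
    (hp : ∀ e ∈ p, e.deg ≤ d ∧ e.rate ≤ K) {n : ℕ} (hn : d ≤ n) (hn1 : 1 ≤ n) :
    |taylorCoeff p n| ≤
      (p.map fun e => |e.coeff| * (K : ℤ) ^ (d - e.deg)).sum *
        ((n : ℤ) ^ d * (K : ℤ) ^ (n - d)) := by
  rw [taylorCoeff, ← List.sum_map_mul_right]
  refine (List.le_sum_of_subadditive _ abs_zero.le abs_add_le _).trans ?_
  rw [List.map_map]
  refine List.sum_le_sum fun e he => ?_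
  obtain ⟨hdeg, hrate⟩ := hp e he
  rw [Function.comp_apply, abs_mul, mul_assoc, Nat.abs_cast]
  refine mul_le_mul_of_nonneg_left ?_ (abs_nonneg _)
  have hnat : n.descFactorial e.deg * e.rate ^ (n - e.deg) ≤
      K ^ (d - e.deg) * (n ^ d * K ^ (n - d)) := by
    calc n.descFactorial e.deg * e.rate ^ (n - e.deg)
        ≤ n ^ d * K ^ (n - e.deg) :=
          Nat.mul_le_mul ((Nat.descFactorial_le_pow _ _).trans (Nat.pow_le_pow_right hn1 hdeg))
            (Nat.pow_le_pow_left hrate _)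
      _ = K ^ (d - e.deg) * (n ^ d * K ^ (n - d)) := by
          rw [← Nat.sub_add_sub_cancel hn hdeg, pow_add]
          ring
  exact_mod_cast hnat

theorem taylorCoeff_append_nonneg {p q : List ExpMonomial} {c : ℤ} {d K M N : ℕ} (hKM : K ≤ M)
    (hd : d ≤ N) (hN : 1 ≤ N)
    (hp : ∀ n, N ≤ n → c * ((n : ℤ) ^ d * (M : ℤ) ^ (n - d)) ≤ taylorCoeff p n)
    (hq : ∀ e ∈ q, e.deg ≤ d ∧ e.rate ≤ K)
    (hdom : (q.map fun e => |e.coeff| * (K : ℤ) ^ (d - e.deg)).sum * (K : ℤ) ^ (N - d) ≤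
      c * (M : ℤ) ^ (N - d))
    (hsmall : ∀ n < N, 0 ≤ taylorCoeff (p ++ q) n) (n : ℕ) : 0 ≤ taylorCoeff (p ++ q) n := by
  rcases lt_or_ge n N with hn | hn
  · exact hsmall n hn
  set S := (q.map fun e => |e.coeff| * (K : ℤ) ^ (d - e.deg)).sum with hS
  have hS0 : 0 ≤ S := List.sum_nonneg fun x hx => by
    obtain ⟨e, -, rfl⟩ := List.mem_map.mp hx
    positivity
  have hpow : S * (K : ℤ) ^ (n - d) ≤ c * (M : ℤ) ^ (n - d) := by
    calc S * (K : ℤ) ^ (n - d) = S * (K : ℤ) ^ (N - d) * (K : ℤ) ^ (n - N) := by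
          rw [mul_assoc, ← pow_add, add_comm (N - d), Nat.sub_add_sub_cancel hn hd]
      _ ≤ c * (M : ℤ) ^ (N - d) * (M : ℤ) ^ (n - N) := by
          refine mul_le_mul hdom ?_ (by positivity) ((by positivity : (0 : ℤ) ≤ _).trans hdom)
          gcongr
      _ = c * (M : ℤ) ^ (n - d) := by
          rw [mul_assoc, ← pow_add, add_comm (N - d), Nat.sub_add_sub_cancel hn hd]
  have hlead := hp n hn
  have htail := neg_le_of_abs_le (abs_taylorCoeff_le hq (hd.trans hn) (hN.trans hn))
  have hscaled := mul_le_mul_of_nonneg_left hpow (by positivity : (0 : ℤ) ≤ (n : ℤ) ^ d)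
  rw [taylorCoeff_append]
  rw [← hS] at htail
  linarith

end ExpPoly

section Phi

theorem phi_succ {z : ℝ} (hz : z ≠ 0) (j : ℕ) :
    phi (j + 1) z = (phi j z - 1 / j.factorial) / z := by
  have hderiv : ∀ s : ℝ, HasDerivAt (fun s => Real.exp ((1 - s) * z) * (s ^ j / j.factorial))
      (Real.exp ((1 - s) * z) * (j * s ^ (j - 1) / j.factorial) -
        z * (Real.exp ((1 - s) * z) * (s ^ j / j.factorial))) s := by
    intro s
    refine ((((hasDerivAt_id s).const_sub 1).mul_const z).exp.mul
      ((hasDerivAt_pow j s).div_const _)).congr_deriv ?_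
    simp only [id]
    ring
  have hparts : (∫ s in (0 : ℝ)..1, Real.exp ((1 - s) * z) * (j * s ^ (j - 1) / j.factorial)) -
      z * phi (j + 1) z = 1 / j.factorial - Real.exp z * (0 ^ j / j.factorial) := by
    rw [phi, ← intervalIntegral.integral_const_mul, ← intervalIntegral.integral_sub
      (Continuous.intervalIntegrable (by fun_prop) 0 1)
      (Continuous.intervalIntegrable (by fun_prop) 0 1),
      intervalIntegral.integral_eq_sub_of_hasDerivAt (fun s _ => hderiv s)
      (Continuous.intervalIntegrable (by fun_prop) 0 1)]
    simp
  rw [eq_div_iff hz]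
  cases j with
  | zero =>
    simp only [CharP.cast_eq_zero, zero_mul, zero_div, mul_zero, intervalIntegral.integral_zero,
      pow_zero] at hparts
    rw [phi]
    linarith
  | succ m =>
    have hphi : phi (m + 1) z = ∫ s in (0 : ℝ)..1,
        Real.exp ((1 - s) * z) * ((m + 1 : ℕ) * s ^ m / (m + 1).factorial) := by
      rw [phi]
      congr 1
      ext s
      rw [Nat.factorial_succ]
      push_cast
      field_simp
    rw [Nat.add_sub_cancel, ← hphi, zero_pow m.succ_ne_zero, zero_div,
      mul_zero] at hparts
    linarith

theorem phi_pos (j : ℕ) (z : ℝ) : 0 < phi j z := by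
  cases j with
  | zero => exact Real.exp_pos z
  | succ m =>
    exact intervalIntegral.intervalIntegral_pos_of_pos_on
      (Continuous.intervalIntegrable (by fun_prop) 0 1)
      (fun s hs => by have := hs.1; positivity) one_pos

theorem phi_one_neg_nat_mul {t : ℝ} (ht : t ≠ 0) {k : ℕ} (hk : k ≠ 0) :
    phi 1 (-(k * t)) = (1 - Real.exp (-t) ^ k) / (k * t) := by
  rw [phi_succ (by simp [ht, hk]), phi, ← Real.exp_nat_mul, mul_neg, div_neg, ← neg_div]
  simp

theorem phi_two_neg_nat_mul {t : ℝ} (ht : t ≠ 0) {k : ℕ} (hk : k ≠ 0) :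
    phi 2 (-(k * t)) = (Real.exp (-t) ^ k - 1 + k * t) / (k * t) ^ 2 := by
  rw [phi_succ (by simp [ht, hk]), phi_one_neg_nat_mul ht hk]
  rw [Nat.factorial_one, Nat.cast_one]
  field_simp
  ring

end Phi

section EERK32

theorem eerk32_succ_self_pos {c₂ c₃ : ℝ} (hc₂ : 0 < c₂) (hc₃ : 0 < c₃)
    (hγ : 0 ≤ gammaParam c₂ c₃) (z : ℝ) : ∀ j ∈ Finset.Icc 1 3, 0 < eerk32 c₂ c₃ (j + 1) j z := by
  have hphi := phi_pos
  intro j hj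
  obtain ⟨hj1, hj3⟩ := Finset.mem_Icc.mp hj
  interval_cases j
  · exact mul_pos hc₂ (hphi _ _)
  · have := hphi 2 (c₂ * z)
    have := hphi 2 (c₃ * z)
    simp only [eerk32]
    positivity
  · have := hphi 2 z
    simp only [eerk32]
    positivity

theorem gammaParam_eq : gammaParam (1 / 2) (7 / 10) = 7 / 25 := by
  norm_num [gammaParam]

/-- The numerators of the coefficients of EERK3-2 for `c₂ = 1/2`, `c₃ = 7/10`: the functions
`z² a_{i,j}(z)` at `z = -10 t`. With this scaling `c₂ z`, `c₃ z` and `z` are integer multiples of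
`t`. -/
def eerk32Numer : ℕ → ℕ → ℝ → ℝ
  | 2, 1, t => 10 * t * (1 - Real.exp (-t) ^ 5)
  | 3, 1, t => 10 * t * (1 - Real.exp (-t) ^ 7) -
      (84 / 5 * t - 64 / 25 + 14 / 25 * Real.exp (-t) ^ 5 + 2 * Real.exp (-t) ^ 7)
  | 3, 2, t => 84 / 5 * t - 64 / 25 + 14 / 25 * Real.exp (-t) ^ 5 + 2 * Real.exp (-t) ^ 7
  | 4, 1, t => 10 * t * (1 - Real.exp (-t) ^ 10) - 32 / 21 * (10 * t - 1 + Real.exp (-t) ^ 10)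
  | 4, 2, t => 1 / 3 * (10 * t - 1 + Real.exp (-t) ^ 10)
  | 4, 3, t => 25 / 21 * (10 * t - 1 + Real.exp (-t) ^ 10)
  | _, _, _ => 0

theorem eerk32_eq_smul_eerk32Numer {t : ℝ} (ht : t ≠ 0) (i j : ℕ) :
    eerk32 (1 / 2) (7 / 10) i j (-(10 * t)) = ((10 * t) ^ 2)⁻¹ * eerk32Numer i j t := by
  have h5 : (1 / 2 : ℝ) * -(10 * t) = -((5 : ℕ) * t) := by
    push_cast
    ring
  have h7 : (7 / 10 : ℝ) * -(10 * t) = -((7 : ℕ) * t) := by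
    push_cast
    ring
  have h10 : -(10 * t) = -((10 : ℕ) * t) := by norm_num
  unfold eerk32 eerk32Numer
  split
  all_goals
    try simp only [↓h5, ↓h7, h10, gammaParam_eq, phi_one_neg_nat_mul ht (by decide : 5 ≠ 0),
      phi_one_neg_nat_mul ht (by decide : 7 ≠ 0), phi_one_neg_nat_mul ht (by decide : 10 ≠ 0),
      phi_two_neg_nat_mul ht (by decide : 5 ≠ 0), phi_two_neg_nat_mul ht (by decide : 7 ≠ 0),
      phi_two_neg_nat_mul ht (by decide : 10 ≠ 0)]
    generalize Real.exp (-t) = y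
    push_cast
    field_simp
    try ring

/-- The matrix congruent to the symmetric part of the differentiation matrix of EERK3-2 at
`z = -10 t`, multiplied by `(10 t)³` to clear the denominators. -/
def eerk32Gram (t : ℝ) : Matrix (Fin 3) (Fin 3) ℝ :=
  (10 * t) • symmPart (diffCoeffMatrix eerk32Numer 3 t) -
    (1 / 2 : ℝ) • Matrix.vecMulVec (weights eerk32Numer 3 t) (weights eerk32Numer 3 t)

theorem symmPart_diffCoeffMatrix_add_eerk32 {t : ℝ} (ht : t ≠ 0) :
    symmPart (diffCoeffMatrix (eerk32 (1 / 2) (7 / 10)) 3 (-(10 * t))) +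
        (-(10 * t) / 2) • Matrix.vecMulVec (weights (eerk32 (1 / 2) (7 / 10)) 3 (-(10 * t)))
          (weights (eerk32 (1 / 2) (7 / 10)) 3 (-(10 * t))) =
      ((10 * t) ^ 3)⁻¹ • eerk32Gram t := by
  ext k l
  simp only [eerk32Gram, symmPart, diffCoeffMatrix, weights, diffCoeff,
    eerk32_eq_smul_eerk32Numer ht, Matrix.smul_apply, Matrix.add_apply, Matrix.sub_apply,
    Matrix.transpose_apply, Matrix.of_apply, Matrix.vecMulVec_apply, smul_eq_mul]
  split_ifs <;> field_simp <;> ring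

theorem eerk32Gram_eq (t : ℝ) :
    eerk32Gram t = (1 / 2 : ℝ) •
      let n := fun i j => eerk32Numer i j t
      !![20 * t * n 2 1 - n 4 1 ^ 2, 10 * t * (n 3 1 - n 2 1) - n 4 1 * n 4 2,
          10 * t * (n 4 1 - n 3 1) - n 4 1 * n 4 3;
        10 * t * (n 3 1 - n 2 1) - n 4 1 * n 4 2, 20 * t * n 3 2 - n 4 2 ^ 2,
          10 * t * (n 4 2 - n 3 2) - n 4 2 * n 4 3;
        10 * t * (n 4 1 - n 3 1) - n 4 1 * n 4 3, 10 * t * (n 4 2 - n 3 2) - n 4 2 * n 4 3,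
          20 * t * n 4 3 - n 4 3 ^ 2] := by
  ext i j
  fin_cases i <;> fin_cases j <;>
    simp only [eerk32Gram, symmPart, diffCoeffMatrix, diffCoeff, weights, Matrix.smul_apply,
      Matrix.add_apply, Matrix.sub_apply, Matrix.transpose_apply, Matrix.of_apply,
      Matrix.vecMulVec_apply, smul_eq_mul, Matrix.cons_val, Fin.reduceFinMk, Fin.isValue,
      Fin.zero_eta, Fin.mk_one, Fin.reduceLE, Fin.val_zero, Fin.val_one, Fin.val_two,
      Nat.reduceAdd, Nat.reduceEqDiff, if_true, if_false, le_refl] <;>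
    ring

theorem isHermitian_eerk32Gram (t : ℝ) : (eerk32Gram t).IsHermitian := by
  refine ((isHermitian_symmPart _).smul (.all _)).sub (.smul ?_ (.all _))
  rw [Matrix.IsHermitian, Matrix.conjTranspose_vecMulVec, star_trivial]

theorem eerk32Gram_corner_pos {t : ℝ} (ht : 0 < t) : 0 < eerk32Gram t 2 2 := by
  have hlower : -(10 * t) + 1 < Real.exp (-(10 * t)) := Real.add_one_lt_exp (by simp [ht.ne'])
  have hupper : Real.exp (-(10 * t)) < 1 := by simpa using ht
  have hexp : Real.exp (-t) ^ 10 = Real.exp (-(10 * t)) := by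
    rw [← Real.exp_nat_mul, mul_neg, Nat.cast_ofNat]
  have hcorner : eerk32Gram t 2 2 =
      eerk32Numer 4 3 t * (2 * (10 * t) - eerk32Numer 4 3 t) / 2 := by
    simp only [eerk32Gram_eq, Matrix.smul_apply, Matrix.of_apply, Matrix.cons_val, smul_eq_mul]
    ring
  rw [hcorner, eerk32Numer, hexp]
  refine half_pos (mul_pos ?_ ?_) <;> linarith

/-- The terms of the largest rate, common to the trailing minor of order two and the determinant
of `eerk32Gram t`, both multiplied by `exp (40 * t)` and by a common denominator. -/
def leadTerms : List ExpMonomial :=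
  [⟨256000, 0, 40⟩, ⟨-4806561, 1, 40⟩, ⟨20079660, 2, 40⟩, ⟨2515100, 3, 40⟩]

/-- The remaining terms of the trailing minor of order two, scaled as in `leadTerms`. -/
def minorTerms : List ExpMonomial :=
  [⟨-56000, 0, 35⟩, ⟨1072372, 1, 35⟩, ⟨-2407160, 2, 35⟩, ⟨-200000, 0, 33⟩, ⟨3829900, 1, 33⟩,
   ⟨-8597000, 2, 33⟩, ⟨-512000, 0, 30⟩, ⟨4624414, 1, 30⟩, ⟨-9075500, 2, 30⟩, ⟨-617400, 1, 28⟩,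
   ⟨-1102500, 1, 26⟩, ⟨112000, 0, 25⟩, ⟨-282100, 1, 25⟩, ⟨400000, 0, 23⟩, ⟨-1007500, 1, 23⟩,
   ⟨256000, 0, 20⟩, ⟨-1710625, 1, 20⟩, ⟨-56000, 0, 15⟩, ⟨-200000, 0, 13⟩]

/-- The remaining terms of the determinant, scaled as in `leadTerms`. -/
def detTerms : List ExpMonomial :=
  [⟨-56000, 0, 35⟩, ⟨1072372, 1, 35⟩, ⟨-2407160, 2, 35⟩, ⟨-200000, 0, 33⟩, ⟨3829900, 1, 33⟩,
   ⟨-8597000, 2, 33⟩, ⟨-512000, 0, 30⟩, ⟨5015039, 1, 30⟩, ⟨-10325500, 2, 30⟩, ⟨-26562500, 3, 30⟩,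
   ⟨-1617400, 1, 28⟩, ⟨19149500, 2, 28⟩, ⟨-42985000, 3, 28⟩, ⟨-462500, 1, 26⟩, ⟨-4400000, 2, 26⟩,
   ⟨-20000000, 3, 26⟩, ⟨112000, 0, 25⟩, ⟨-1962100, 1, 25⟩, ⟨15550500, 2, 25⟩, ⟨-36015000, 3, 25⟩,
   ⟨400000, 0, 23⟩, ⟨-3157900, 1, 23⟩, ⟨16579500, 2, 23⟩, ⟨-30135000, 3, 23⟩, ⟨-11025000, 2, 21⟩,
   ⟨256000, 0, 20⟩, ⟨-318039, 1, 20⟩, ⟨-8934160, 2, 20⟩, ⟨-14817600, 3, 20⟩, ⟨3782900, 1, 18⟩,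
   ⟨-8754500, 2, 18⟩, ⟨400000, 1, 16⟩, ⟨-1375000, 2, 16⟩, ⟨-56000, 0, 15⟩, ⟨889728, 1, 15⟩,
   ⟨-10763340, 2, 15⟩, ⟨-200000, 0, 13⟩, ⟨-672000, 1, 13⟩, ⟨-4777500, 2, 13⟩, ⟨109561, 1, 10⟩,
   ⟨-2165500, 1, 8⟩, ⟨62500, 1, 6⟩]

theorem le_taylorCoeff_leadTerms {n : ℕ} (hn : 11 ≤ n) :
    2515100 * ((n : ℤ) ^ 3 * 40 ^ (n - 3)) ≤ taylorCoeff leadTerms n := by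
  obtain ⟨m, rfl⟩ := Nat.exists_eq_add_of_le' (show 3 ≤ n by omega)
  have hm : (8 : ℤ) ≤ m := by omega
  have hdiff : taylorCoeff leadTerms (m + 3) - 2515100 * (((m + 3 : ℕ) : ℤ) ^ 3 * 40 ^ m) =
      40 ^ m * ((m + 3) * (795641100 * (m + 3) - 8488653800) + 16384000000) := by
    simp only [taylorCoeff, leadTerms, List.map_cons, List.map_nil, List.sum_cons, List.sum_nil,
      Nat.descFactorial_succ, Nat.descFactorial_zero, Nat.sub_zero, Nat.reduceSubDiff,
      Nat.add_sub_cancel]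
    push_cast
    ring
  have hrest : 0 ≤ (40 : ℤ) ^ m * ((m + 3) * (795641100 * (m + 3) - 8488653800) + 16384000000) := by
    refine mul_nonneg (by positivity) (add_nonneg (mul_nonneg ?_ ?_) ?_) <;> linarith [hm]
  rw [Nat.add_sub_cancel]
  linarith

theorem eerk32_minor_expPoly_pos {t : ℝ} (ht : 0 < t) : 0 < expPoly (leadTerms ++ minorTerms) t :=
  expPoly_pos (m := 5) (taylorCoeff_append_nonneg (c := 2515100) (d := 3) (K := 35) (M := 40)
    (N := 100) (by decide) (by decide) (by decide)
    (fun _ hn => le_taylorCoeff_leadTerms (by omega)) (by decide +kernel) (by decide +kernel)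
    (by decide +kernel)) (by decide +kernel) ht

theorem eerk32_det_expPoly_pos {t : ℝ} (ht : 0 < t) : 0 < expPoly (leadTerms ++ detTerms) t :=
  expPoly_pos (m := 6) (taylorCoeff_append_nonneg (c := 2515100) (d := 3) (K := 35) (M := 40)
    (N := 100) (by decide) (by decide) (by decide)
    (fun _ hn => le_taylorCoeff_leadTerms (by omega)) (by decide +kernel) (by decide +kernel)
    (by decide +kernel)) (by decide +kernel) ht

theorem eerk32Gram_minor_mul_exp (t : ℝ) :
    Real.exp (40 * t) *
        (eerk32Gram t 1 1 * eerk32Gram t 2 2 - eerk32Gram t 1 2 * eerk32Gram t 2 1) =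
      10 * t / 110250 * expPoly (leadTerms ++ minorTerms) t := by
  rw [expPoly_eq_exp_mul (M := 40) (by decide)]
  simp only [eerk32Gram_eq, Matrix.smul_apply, Matrix.of_apply, Matrix.cons_val, smul_eq_mul,
    eerk32Numer, leadTerms, minorTerms, List.cons_append, List.nil_append, List.map_cons,
    List.map_nil, List.sum_cons, List.sum_nil, Nat.reduceSub]
  push_cast
  ring

theorem eerk32Gram_det_mul_exp (t : ℝ) :
    Real.exp (40 * t) * (eerk32Gram t).det =
      (10 * t) ^ 3 / 220500 * expPoly (leadTerms ++ detTerms) t := by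
  rw [expPoly_eq_exp_mul (M := 40) (by decide), Matrix.det_fin_three]
  simp only [eerk32Gram_eq, Matrix.smul_apply, Matrix.of_apply, Matrix.cons_val, smul_eq_mul,
    eerk32Numer, leadTerms, detTerms, List.cons_append, List.nil_append, List.map_cons,
    List.map_nil, List.sum_cons, List.sum_nil, Nat.reduceSub]
  push_cast
  ring

theorem posDef_eerk32Gram {t : ℝ} (ht : 0 < t) : (eerk32Gram t).PosDef := by
  refine posDef_fin_three (isHermitian_eerk32Gram t) (eerk32Gram_corner_pos ht) ?_ ?_
  · refine pos_of_mul_pos_right ?_ (Real.exp_pos (40 * t)).le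
    have := eerk32_minor_expPoly_pos ht
    rw [eerk32Gram_minor_mul_exp]
    positivity
  · refine pos_of_mul_pos_right ?_ (Real.exp_pos (40 * t)).le
    have := eerk32_det_expPoly_pos ht
    rw [eerk32Gram_det_mul_exp]
    positivity

theorem gammaParam_nonneg : 0 ≤ gammaParam (1 / 2) (7 / 10) := by
  rw [gammaParam_eq]
  norm_num

theorem posDef_symmPart_diffMatrix_eerk32 {z : ℝ} (hz : z < 0) :
    (symmPart (diffMatrix (eerk32 (1 / 2) (7 / 10)) 3 z)).PosDef := by
  obtain ⟨t, rfl⟩ : ∃ t, z = -(10 * t) := ⟨-z / 10, by ring⟩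
  have ht : 0 < t := by linarith
  rw [posDef_symmPart_diffMatrix_iff fun j hj =>
    (eerk32_succ_self_pos (by norm_num) (by norm_num) gammaParam_nonneg _ j hj).ne',
    symmPart_diffCoeffMatrix_add_eerk32 ht.ne']
  exact (posDef_eerk32Gram ht).smul (by positivity)

end EERK32
end EERK

end

theorem mainTheorem9_general {ι : Type*} [Fintype ι] [DecidableEq ι] :
    (∀ z : ℝ, z < 0 →
      (EERK.symmPart (EERK.diffMatrix (EERK.eerk32 (1 / 2) (7 / 10)) 3 z)).PosDef) ∧
    ∀ (L : Matrix ι ι ℝ) (κ : ℝ) (_hL : (EERK.stabL L κ).PosDef)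
      (g : EuclideanSpace ℝ ι → EuclideanSpace ℝ ι)
      (G : EuclideanSpace ℝ ι → ι → ℝ)
      (_hgG : ∀ v, HasGradientAt (fun w => ∑ i, G w i) (-g v) v)
      (ℓ : ℝ) (_hLip : ∀ u v, ‖g u - g v‖ ≤ ℓ * ‖u - v‖) (_hκ : ℓ ≤ κ)
      (τ : ℝ) (_hτ : 0 < τ) (U : ℕ → EuclideanSpace ℝ ι)
      (_hU : EERK.IsStep (EERK.eerk32 (1 / 2) (7 / 10)) 3 L g κ τ U),
      ∀ j ∈ Finset.Icc 1 3,
        EERK.energy L G (U (j + 1)) - EERK.energy L G (U 1) ≤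
          -(1 / τ) * EERK.dissipation (EERK.eerk32 (1 / 2) (7 / 10)) L κ τ U j ∧
        0 ≤ EERK.dissipation (EERK.eerk32 (1 / 2) (7 / 10)) L κ τ U j ∧
        EERK.energy L G (U (j + 1)) ≤ EERK.energy L G (U 1) := by
  have hposDef := fun z (hz : z < 0) => EERK.posDef_symmPart_diffMatrix_eerk32 hz
  refine ⟨hposDef, fun L κ hL g G hgG ℓ hLip hκ τ hτ U hU j hj => ?_⟩
  have hj3 := (Finset.mem_Icc.mp hj).2
  have hlaw := hU.energy_sub_le hL hgG hLip hκ hτ (fun z _ j hj => (EERK.eerk32_succ_self_pos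
    (by norm_num) (by norm_num) EERK.gammaParam_nonneg z j hj).ne') hj3
  have hnonneg := EERK.dissipation_nonneg (U := U) hL hτ (fun z hz => (hposDef z hz).posSemidef) hj3
  refine ⟨hlaw, hnonneg, sub_nonpos.mp (hlaw.trans ?_)⟩
  exact mul_nonpos_of_nonpos_of_nonneg (neg_nonpos.mpr (by positivity)) hnonneg

theorem mainTheorem9 {ι : Type*} [Fintype ι] [DecidableEq ι] :
    (∀ z : ℝ, z < 0 →
      (EERK.symmPart (EERK.diffMatrix (EERK.eerk32 (1 / 2) (7 / 10)) 3 z)).PosDef) ∧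
    ∀ (L : Matrix ι ι ℝ) (_hL : L.PosDef)
      (g : EuclideanSpace ℝ ι → EuclideanSpace ℝ ι)
      (G : EuclideanSpace ℝ ι → ι → ℝ) (_hG : ∀ v i, 0 ≤ G v i)
      (_hgG : ∀ v, HasGradientAt (fun w => ∑ i, G w i) (-g v) v)
      (ℓ : ℝ) (_hℓ : 0 < ℓ) (_hLip : ∀ u v, ‖g u - g v‖ ≤ ℓ * ‖u - v‖)
      (κ : ℝ) (_hκ : 2 * ℓ ≤ κ)
      (τ : ℕ → ℝ) (_hτ : ∀ n, 1 ≤ n → 0 < τ n)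
      (u : ℕ → EuclideanSpace ℝ ι) (U : ℕ → ℕ → EuclideanSpace ℝ ι)
      (_hU : EERK.IsSolution (EERK.eerk32 (1 / 2) (7 / 10)) 3 L g κ τ u U),
      ∀ n, 1 ≤ n → ∀ j ∈ Finset.Icc 1 3,
        EERK.energy L G (U n (j + 1)) - EERK.energy L G (U n 1) ≤
          -(1 / τ n) * EERK.dissipation (EERK.eerk32 (1 / 2) (7 / 10)) L κ (τ n) (U n) j ∧
        0 ≤ EERK.dissipation (EERK.eerk32 (1 / 2) (7 / 10)) L κ (τ n) (U n) j ∧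
        EERK.energy L G (U n (j + 1)) ≤ EERK.energy L G (U n 1) := by
  exact ⟨(mainTheorem9_general (ι := ι)).1, fun L hL g G _ hgG ℓ hℓ hLip κ hκ τ hτ _ U hU n hn =>
    mainTheorem9_general.2 L κ (hL.add_posSemidef (Matrix.PosSemidef.one.smul (by linarith))) g G
      hgG ℓ hLip (by linarith) (τ n) (hτ n hn) (U n) (hU n hn).2.1⟩
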